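/- Let $G=(Y,Z,E)$ be a finite bipartite graph of ball types $Y$ and bins $Z$ in which every ball type has rate $1$, so that $b=|Y|$ balls arrive, their types $\omega=(y_1,\dots,y_b)$ being independent and uniformly distributed on $Y$. For every sequence $\omega$ let $F(\omega)$ be a fixed maximum-cardinality matching between the $b$ balls and the bins, where a ball of type $y$ may be matched to any $z$ with $(y,z)\in E$. Let $\mathrm{OPT}(\omega)$ be its size, and for $e=(y,z)\in E$ let $f_e$ be the probability that $F(\omega)$ matches a ball of type $y$ to the bin $z$. Then there is a probability distribution $\mu$ on the set of matchings of $G$ with $$\sum_{M\ni e}\mu(M)=f_e\qquad\text{for all } e\in E .$$ For every such $\mu$, consider the following non-adaptive online algorithm. Sample two matchings $M_1,M_2$ of $G$ from $\mu$, independently of each other and of the arrivals. When the first ball of a type $y$ arrives, allocate it to the bin matched to $y$ in $M_1$; when the second ball of type $y$ arrives, allocate it to the bin matched to $y$ in $M_2$; drop every ball whose bin does not exist or is already full, and every later ball of type $y$. If $\mathrm{ALG}$ denotes the number of non-empty bins after all $b$ balls have arrived, then $$\mathbb{E}[\mathrm{ALG}]\;\ge\;0.684\cdot\mathbb{E}[\mathrm{OPT}],$$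 i.e. the competitive ratio $\mathbb{E}[\mathrm{ALG}]/\mathbb{E}[\mathrm{OPT}]$ is at least $0.684$ whenever $\mathbb{E}[\mathrm{OPT}]>0$. -/

import Mathlib

open scoped BigOperators

namespace StochMatching

variable {A Y Z : Type*}

/-- A matching of the bipartite graph with sides `A`, `Z` and edge relation `E`, given by the
partner in `Z` of each `a : A` (`none` if `a` is unmatched). -/
def IsMatching (E : A → Z → Prop) (m : A → Option Z) : Prop :=
  (∀ a z, m a = some z → E a z) ∧ ∀ a a' z, m a = some z → m a' = some z → a = a'

/-- The number of edges of a matching. -/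
def size [Fintype A] (m : A → Option Z) : ℕ :=
  (Finset.univ.filter fun a => (m a).isSome = true).card

/-- A matching with the largest possible number of edges. -/
def IsMaximumMatching [Fintype A] (E : A → Z → Prop) (m : A → Option Z) : Prop :=
  IsMatching E m ∧ ∀ m' : A → Option Z, IsMatching E m' → size m' ≤ size m

/-- Probability of the arrival sequence `ω = (ω 0, …, ω (b - 1))`: the balls are independent and
each of them has type `y` with probability proportional to the rate `r y`. -/
noncomputable def seqProb [Fintype Y] (r : Y → ℝ) {b : ℕ} (ω : Fin b → Y) : ℝ :=
  ∏ t, r (ω t) / ∑ y, r y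

/-- An offline optimum: to every arrival sequence `ω` it assigns a maximum matching between the
balls `t : Fin b` and the bins, ball `t` being adjacent to the neighbours of its type `ω t`. -/
def IsOfflineOptimum (E : Y → Z → Prop) {b : ℕ} (F : (Fin b → Y) → Fin b → Option Z) : Prop :=
  ∀ ω, IsMaximumMatching (fun t z => E (ω t) z) (F ω)

/-- `E[OPT]`: the expected number of balls that the offline optimum allocates. -/
noncomputable def expectedOpt [Fintype Y] (r : Y → ℝ) {b : ℕ}
    (F : (Fin b → Y) → Fin b → Option Z) : ℝ :=
  ∑ ω, seqProb r ω * (size (F ω) : ℝ)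

/-- The number of balls of type `y` that the offline optimum puts into bin `z` on input `ω`
(it is `0` or `1`, as `z` receives at most one ball). -/
def usesEdge [DecidableEq Y] [DecidableEq Z] {b : ℕ} (F : (Fin b → Y) → Fin b → Option Z)
    (ω : Fin b → Y) (y : Y) (z : Z) : ℕ :=
  (Finset.univ.filter fun t => ω t = y ∧ F ω t = some z).card

/-- The fractional matching `f` defined by the offline optimum. -/
noncomputable def fracMatching [Fintype Y] [DecidableEq Y] [DecidableEq Z] (r : Y → ℝ) {b : ℕ}
    (F : (Fin b → Y) → Fin b → Option Z) (y : Y) (z : Z) : ℝ :=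
  ∑ ω, seqProb r ω * (usesEdge F ω y z : ℝ)

/-- `μ` is a probability distribution on the matchings of the graph `E` in which every edge
`(y, z)` belongs to the random matching with probability `f y z`. -/
structure IsMatchingDistribution [Fintype Y] [Fintype Z] [DecidableEq Y] [DecidableEq Z]
    (E : Y → Z → Prop) (f : Y → Z → ℝ) (μ : (Y → Option Z) → ℝ) : Prop where
  nonneg : ∀ m, 0 ≤ μ m
  sum_eq_one : ∑ m, μ m = 1
  support : ∀ m, μ m ≠ 0 → IsMatching E m
  marginal : ∀ y z, E y z → ∑ m with m y = some z, μ m = f y z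

/-- Ball `t` is the `arrivalNumber ω t`-th ball of its type (counting from `1`). -/
def arrivalNumber [DecidableEq Y] {b : ℕ} (ω : Fin b → Y) (t : Fin b) : ℕ :=
  (Finset.univ.filter fun s => s ≤ t ∧ ω s = ω t).card

/-- The bin to which the algorithm tries to allocate ball `t`: the first ball of a type goes through
the first priority matching `M₁`, the second one through the second priority matching `M₂`, and all
later ones are dropped. -/
def triedBin [DecidableEq Y] (M₁ M₂ : Y → Option Z) {b : ℕ} (ω : Fin b → Y) (t : Fin b) :
    Option Z :=
  if arrivalNumber ω t = 1 then M₁ (ω t)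
  else if arrivalNumber ω t = 2 then M₂ (ω t)
  else none

/-- One online step: a ball is allocated to the bin tried for it if that bin is empty, and is
dropped if the bin is full or if there is no such bin. -/
def step [DecidableEq Z] (full : Finset Z) (target : Option Z) : Finset Z :=
  match target with
  | none => full
  | some z => if z ∈ full then full else insert z full

/-- The set of non-empty bins after the first `n` balls (all bins are empty at the start). -/
def fullBins [DecidableEq Y] [DecidableEq Z] (M₁ M₂ : Y → Option Z) {b : ℕ} (ω : Fin b → Y) :
    ℕ → Finset Z
  | 0 => ∅
  | n + 1 =>
    if h : n < b then step (fullBins M₁ M₂ ω n) (triedBin M₁ M₂ ω ⟨n, h⟩)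
    else fullBins M₁ M₂ ω n

/-- `E[ALG]`: the expected number of non-empty bins after all `b` balls, where `M₁`, `M₂` are
sampled from `μ` independently of each other and of the arrival sequence. -/
noncomputable def expectedAlg [Fintype Y] [Fintype Z] [DecidableEq Y] [DecidableEq Z]
    (r : Y → ℝ) (b : ℕ) (μ : (Y → Option Z) → ℝ) : ℝ :=
  ∑ M₁, ∑ M₂, ∑ ω : Fin b → Y,
    μ M₁ * μ M₂ * seqProb r ω * ((fullBins M₁ M₂ ω b).card : ℝ)

end StochMatching

/-! Fix a bin `z` and put `F = ∑ y, f y z`, `S = ∑ y, f y z ^ 2`. If `z` stays empty, its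
`M₁`-partner never arrives and its `M₂`-partner arrives at most once. This bounds the probability
that `z` is empty in terms of the partners alone (`emptyProb_le`). As `M₁`, `M₂` are independent
with marginals `f`, averaging yields a quadratic in `F` and `S` (`sum_sum_mul_emptyProb_le`), in
which a large `S` hurts: two equal partners are worse than two distinct ones.

What limits `S` is that `f` comes from an offline optimum: a set of `k` types can use `z` only if
one of them arrives, so their `f`-mass is at most `1 - (1 - k/b)^b` (`sum_fracMatching_le`).
Applying this to the three largest values bounds `S` (`sum_sq_le_of_card_le_three`), and
`quadratic_bound` compares with `0.684 * F`; for large `b` and `F = 1` the estimate gives about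
0.6841. Summing over bins finishes, since `E[OPT]` is the total mass of `f`.

The distribution `μ` exists by Birkhoff's theorem. -/

namespace StochMatching

/-! ### Exponential estimates and the bound on the sum of squares. -/

/-- Quantitative converse of `Real.one_sub_div_pow_le_exp_neg`. -/
lemma exp_neg_mul_one_sub_le_pow {k : ℝ} {b : ℕ} (hk : 0 ≤ k) (hb : 0 < b) (hkb : k ≤ b) :
    Real.exp (-k) * (1 - k ^ 2 / b) ≤ (1 - k / b) ^ b := by
  have hb' : (0 : ℝ) < b := by exact_mod_cast hb
  have hu0 : 0 ≤ k / b := by positivity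
  have hu1 : k / b ≤ 1 := (div_le_one hb').2 hkb
  set u := k / b with hu
  have hku : k = b * u := by rw [hu]; field_simp
  have h1 : Real.exp (-u) * (1 - u ^ 2) ≤ 1 - u := by
    have h2 : Real.exp (-u) * (1 + u) ≤ 1 := by
      have := Real.add_one_le_exp u
      calc Real.exp (-u) * (1 + u) ≤ Real.exp (-u) * Real.exp u := by gcongr; linarith
        _ = 1 := by rw [← Real.exp_add]; simp
    nlinarith
  calc Real.exp (-k) * (1 - k ^ 2 / b) = Real.exp (-u) ^ b * (1 + b * (-u ^ 2)) := by
        rw [← Real.exp_nat_mul, hku]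
        congr 1
        · ring_nf
        · field_simp; ring
    _ ≤ Real.exp (-u) ^ b * (1 + -u ^ 2) ^ b := by
        gcongr
        exact one_add_mul_le_pow (by nlinarith) b
    _ = (Real.exp (-u) * (1 - u ^ 2)) ^ b := by rw [mul_pow]; ring
    _ ≤ (1 - u) ^ b := by
        gcongr
        exact mul_nonneg (Real.exp_nonneg _) (by nlinarith)

/-- Apply `log (1 + u) ≥ 2u / (u + 2)` with `u = 2 / (b - 2)`: then `1 + u` is the inverse of `1 -
2/b` and the right side is exactly `2 / (b - 1)`. -/
lemma one_sub_two_div_pow_pred_le {b : ℕ} (hb : 3 ≤ b) :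
    (1 - 2 / (b : ℝ)) ^ (b - 1) ≤ Real.exp (-1) ^ 2 := by
  have hb' : (3 : ℝ) ≤ b := by exact_mod_cast hb
  have hpos : 0 < 1 - 2 / (b : ℝ) := by
    rw [sub_pos, div_lt_one] <;> linarith
  have hu : (0 : ℝ) ≤ 2 / (b - 2) := div_nonneg (by norm_num) (by linarith)
  have hl := Real.le_log_one_add_of_nonneg hu
  have hb0 : (b : ℝ) ≠ 0 := by linarith
  have h1 : 1 + 2 / ((b : ℝ) - 2) = (1 - 2 / (b : ℝ))⁻¹ := by
    have : (b : ℝ) - 2 ≠ 0 := by linarith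
    rw [one_sub_div hb0, inv_div, eq_div_iff this, add_mul, div_mul_cancel₀ _ this]
    ring
  have h2 : 2 * (2 / ((b : ℝ) - 2)) / (2 / (b - 2) + 2) = 2 / (b - 1) := by
    have : (b : ℝ) - 2 ≠ 0 := by linarith
    have : (b : ℝ) - 1 ≠ 0 := by linarith
    have h : 2 / ((b : ℝ) - 2) + 2 = 2 * (b - 1) / (b - 2) := by field_simp; ring
    rw [h]
    field_simp
  rw [h1, h2, Real.log_inv] at hl
  rw [← Real.exp_log hpos, ← Real.exp_nat_mul, ← Real.exp_nat_mul, Real.exp_le_exp]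
  have h3 : 2 / ((b : ℝ) - 1) * (b - 1) = 2 := by
    have : (b : ℝ) - 1 ≠ 0 := by linarith
    field_simp
  push_cast [Nat.cast_sub (show 1 ≤ b by omega)]
  nlinarith

/-- If the largest values of `f` have small partial sums, then `∑ f ^ 2` is small. -/
lemma sum_sq_le_of_card_le_three {Y : Type*} [Fintype Y] [DecidableEq Y] {f : Y → ℝ}
    (hf : ∀ y, 0 ≤ f y) (hY : 3 ≤ Fintype.card Y) (hf1 : ∑ y, f y ≤ 1) {g₁ g₂ g₃ : ℝ}
    (h₁ : ∀ T : Finset Y, T.card = 1 → ∑ y ∈ T, f y ≤ g₁)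
    (h₂ : ∀ T : Finset Y, T.card = 2 → ∑ y ∈ T, f y ≤ g₂)
    (h₃ : ∀ T : Finset Y, T.card = 3 → ∑ y ∈ T, f y ≤ g₃)
    (hg₂ : g₂ ≤ 1) (hg : 1 - g₂ ≤ g₂ - g₁) (hg' : g₂ - g₁ ≤ g₁) :
    ∑ y, f y ^ 2 ≤ g₁ ^ 2 + (g₂ - g₁) ^ 2 + (g₃ - g₂) * (1 - g₂) := by
  obtain ⟨a, -, ha⟩ := Finset.exists_max_image Finset.univ f
    (Finset.card_pos.1 (by rw [Finset.card_univ]; omega))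
  have hc1 : (Finset.univ.erase a).card = Fintype.card Y - 1 := by
    rw [Finset.card_erase_of_mem (Finset.mem_univ _), Finset.card_univ]
  obtain ⟨c, hc, hcm⟩ := Finset.exists_max_image (Finset.univ.erase a) f
    (Finset.card_pos.1 (by omega))
  have hc2 : ((Finset.univ.erase a).erase c).card = Fintype.card Y - 2 := by
    rw [Finset.card_erase_of_mem hc, hc1]; omega
  obtain ⟨d, hd, hdm⟩ := Finset.exists_max_image ((Finset.univ.erase a).erase c) f
    (Finset.card_pos.1 (by omega))
  have hca : c ≠ a := Finset.ne_of_mem_erase hc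
  have hdc : d ≠ c := Finset.ne_of_mem_erase hd
  have hda : d ≠ a := Finset.ne_of_mem_erase (Finset.mem_of_mem_erase hd)
  have e (g : Y → ℝ) : ∑ y, g y = g a + g c + ∑ y ∈ (Finset.univ.erase a).erase c, g y := by
    rw [← Finset.add_sum_erase _ g (Finset.mem_univ a), ← Finset.add_sum_erase _ g hc]; ring
  have hrest : ∑ y ∈ (Finset.univ.erase a).erase c, f y ^ 2 ≤
      f d * ∑ y ∈ (Finset.univ.erase a).erase c, f y := by
    rw [Finset.mul_sum]
    refine Finset.sum_le_sum fun y hy => ?_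
    rw [sq]
    exact mul_le_mul_of_nonneg_right (hdm y hy) (hf y)
  have k1 := h₁ {a} (by simp)
  have k2 := h₂ {a, c} (Finset.card_pair hca.symm)
  have k3 := h₃ {a, c, d} (Finset.card_eq_three.2 ⟨a, c, d, hca.symm, hda.symm, hdc.symm, rfl⟩)
  rw [Finset.sum_singleton] at k1
  rw [Finset.sum_pair hca.symm] at k2
  rw [Finset.sum_insert (by simp [hca.symm, hda.symm]), Finset.sum_pair hdc.symm] at k3
  have hac := ha c (Finset.mem_univ _)
  have hcd := hcm d (Finset.mem_of_mem_erase hd)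
  rw [e] at hf1 ⊢
  have hd0 := hf d
  set R := ∑ y ∈ (Finset.univ.erase a).erase c, f y
  -- Abel summation: the slack is a combination of the partial-sum slacks with weights `f a - f c`,
  -- `f c - f d` and `f d`. The next step repeats this with the decreasing weights `g₁`, `g₂ - g₁`,
  -- `1 - g₂`.
  have s1 : f a ^ 2 + f c ^ 2 + f d * R ≤ f a * g₁ + f c * (g₂ - g₁) + f d * (1 - g₂) := by
    nlinarith [mul_nonneg (sub_nonneg.2 hac) (sub_nonneg.2 k1),
      mul_nonneg (sub_nonneg.2 hcd) (sub_nonneg.2 k2), mul_nonneg hd0 (sub_nonneg.2 hf1)]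
  have s2 : f a * g₁ + f c * (g₂ - g₁) + f d * (1 - g₂) ≤
      g₁ ^ 2 + (g₂ - g₁) ^ 2 + (g₃ - g₂) * (1 - g₂) := by
    nlinarith [mul_nonneg (sub_nonneg.2 hg') (sub_nonneg.2 k1),
      mul_nonneg (sub_nonneg.2 hg) (sub_nonneg.2 k2),
      mul_nonneg (sub_nonneg.2 hg₂) (sub_nonneg.2 k3)]
  linarith

end StochMatching
-- The quadratic inequality for one bin.
namespace StochMatching

/-- After inserting the bound on `S`, the difference of the two sides is `F` times an affine
function of `F`; `h0` and `h1` are its values at `F = 0` and `F = 1`. -/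
lemma quadratic_bound_of_linear {p p' q F S : ℝ} (hF0 : 0 ≤ F) (hF1 : F ≤ 1) (hpq : q ≤ p)
    (hS : S ≤ (1 - p) * F) (h0 : 0.684 ≤ 2 - (p + p') - (p - q) * (1 - p))
    (h1 : 0.684 ≤ 1 - q - (p - q) * (1 - p)) :
    0.684 * F ≤ 1 - ((1 - F) ^ 2 + (p + p') * (F * (1 - F)) + p * S + q * (F ^ 2 - S)) := by
  have h2 : (p - q) * S ≤ (p - q) * ((1 - p) * F) :=
    mul_le_mul_of_nonneg_left hS (sub_nonneg.2 hpq)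
  have h3 : 0 ≤ F * ((1 - F) * (2 - (p + p') - (p - q) * (1 - p) - 0.684) +
      F * (1 - q - (p - q) * (1 - p) - 0.684)) := by
    apply mul_nonneg hF0
    apply add_nonneg <;> apply mul_nonneg <;> linarith
  nlinarith

/-- Below 0.76 the bound `S ≤ F ^ 2` suffices. Above it `S ≤ B` makes the difference concave in `F`
(by `hQC`), so the endpoints 1 and 0.76 are enough; these are `h1` and `h2`. -/
lemma quadratic_bound_of_sq {P C Q F S B : ℝ} (hF0 : 0 ≤ F) (hF1 : F ≤ 1)
    (hQP : Q ≤ P) (hS : S ≤ F ^ 2) (hSB : S ≤ B) (hP : P ≤ 0.3679)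
    (hC : C ≤ 1.1446) (hQC : C - 1 ≤ Q) (h1 : Q + (P - Q) * B ≤ 0.316)
    (h2 : 0.5776 * (Q - C + 1) + (P - Q) * B ≤ (1.316 - C) * 0.76) :
    0.684 * F ≤ 1 - ((1 - F) ^ 2 + C * (F * (1 - F)) + P * S + Q * (F ^ 2 - S)) := by
  rcases le_total F 0.76 with h | h
  · have h3 : (P - Q) * S ≤ (P - Q) * F ^ 2 :=
      mul_le_mul_of_nonneg_left hS (sub_nonneg.2 hQP)
    have h4 : 0 ≤ F * (1.316 - C - F * (1 - C + P)) := by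
      apply mul_nonneg hF0
      nlinarith
    nlinarith
  · have h3 : (P - Q) * S ≤ (P - Q) * B :=
      mul_le_mul_of_nonneg_left hSB (sub_nonneg.2 hQP)
    have h4 := mul_nonneg (sub_nonneg.2 hF1) (sub_nonneg.2 h2)
    have h5 := mul_nonneg (sub_nonneg.2 h) (sub_nonneg.2 h1)
    have h6 := mul_nonneg (mul_nonneg (sub_nonneg.2 hF1) (sub_nonneg.2 h)) (sub_nonneg.2 hQC)
    nlinarith

/-- The bound on `∑ f ^ 2` for `n` types, in terms of `e = exp (-1)` and `x = 1 / n`. -/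
lemma numeric_bounds {e x : ℝ} (he0 : 0.367879 < e) (he1 : e < 0.36788) (hx0 : 0 ≤ x)
    (hx1 : x ≤ 1 / 11) :
    2 * e ^ 2 * (1 - x) + (e - 2 * e ^ 2 * (1 - x)) *
      ((1 - e * (1 - x)) ^ 2 + (e * (1 - x) - e ^ 2 * (1 - 4 * x)) ^ 2 +
        (e ^ 2 * (1 - 4 * x) - e ^ 3 * (1 - 9 * x)) * (e ^ 2 * (1 - 4 * x))) ≤ 0.316 ∧
    (e - 2 * e ^ 2 * (1 - x)) *
      ((1 - e * (1 - x)) ^ 2 + (e * (1 - x) - e ^ 2 * (1 - 4 * x)) ^ 2 +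
        (e ^ 2 * (1 - 4 * x) - e ^ 3 * (1 - 9 * x)) * (e ^ 2 * (1 - 4 * x))) ≤ 0.0663 := by
  have e2l : 0.135334 < e ^ 2 := by nlinarith
  have e2u : e ^ 2 < 0.135336 := by nlinarith
  have e3l : 0.049786 < e ^ 3 := by nlinarith
  have e3u : e ^ 3 < 0.0497875 := by nlinarith
  generalize e ^ 3 = e₃ at *
  generalize e ^ 2 = e₂ at *
  have b1 : (1 - e * (1 - x)) ^ 2 ≤ (0.632121 + 0.36788 * x) ^ 2 := by
    apply pow_le_pow_left₀ <;> nlinarith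
  have b2 : (e * (1 - x) - e₂ * (1 - 4 * x)) ^ 2 ≤ (0.232546 + 0.173465 * x) ^ 2 := by
    apply pow_le_pow_left₀ <;> nlinarith
  have b3 : (e₂ * (1 - 4 * x) - e₃ * (1 - 9 * x)) * (e₂ * (1 - 4 * x)) ≤
      0.08555 * 0.135336 := by
    apply mul_le_mul <;> nlinarith
  have b4 : (1 - e * (1 - x)) ^ 2 + (e * (1 - x) - e₂ * (1 - 4 * x)) ^ 2 +
      (e₂ * (1 - 4 * x) - e₃ * (1 - 9 * x)) * (e₂ * (1 - 4 * x)) ≤ 0.46524 + 0.562 * x := by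
    nlinarith
  set B := (1 - e * (1 - x)) ^ 2 + (e * (1 - x) - e₂ * (1 - 4 * x)) ^ 2 +
      (e₂ * (1 - 4 * x) - e₃ * (1 - 9 * x)) * (e₂ * (1 - 4 * x)) with hB
  have hPQ0 : 0 ≤ e - 2 * e₂ * (1 - x) := by nlinarith
  have hPQ1 : e - 2 * e₂ * (1 - x) ≤ 0.097212 + 0.270672 * x := by nlinarith
  have b5 : (e - 2 * e₂ * (1 - x)) * B ≤ (0.097212 + 0.270672 * x) * (0.46524 + 0.562 * x) :=
    (mul_le_mul_of_nonneg_left b4 hPQ0).trans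
      (mul_le_mul_of_nonneg_right hPQ1 (by positivity))
  constructor <;> nlinarith

/-- The right side decreases in each of the three coefficients, so they may be replaced by the upper
bounds `e⁻¹`, `1.1446` and `2 e⁻² (1 - 1/b)`. The mass bounds for one, two and three types are
relaxed to `1 - e⁻ᵏ (1 - k²/b)`. -/
lemma quadratic_bound_of_card {Y : Type*} [Fintype Y] [DecidableEq Y] {f : Y → ℝ} {b : ℕ}
    (hb : 11 ≤ b) (hY : Fintype.card Y = b) (hf : ∀ y, 0 ≤ f y) (hf1 : ∑ y, f y ≤ 1)
    (hT : ∀ T : Finset Y, ∑ y ∈ T, f y ≤ 1 - (1 - (T.card : ℝ) / b) ^ b)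
    (hsq : ∑ y, f y ^ 2 ≤ (∑ y, f y) ^ 2) :
    0.684 * ∑ y, f y ≤ 1 - ((1 - ∑ y, f y) ^ 2 +
      ((1 - 1 / (b : ℝ)) ^ b + ((1 - 1 / (b : ℝ)) ^ b + (1 - 1 / (b : ℝ)) ^ (b - 1))) *
        ((∑ y, f y) * (1 - ∑ y, f y)) +
      (1 - 1 / (b : ℝ)) ^ b * ∑ y, f y ^ 2 +
      ((1 - 2 / (b : ℝ)) ^ b + (1 - 2 / (b : ℝ)) ^ (b - 1)) *
        ((∑ y, f y) ^ 2 - ∑ y, f y ^ 2)) := by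
  have hbR : (11 : ℝ) ≤ b := by exact_mod_cast hb
  have hb0 : (b : ℝ) ≠ 0 := by linarith
  have he0 := Real.exp_neg_one_gt_d9
  have he1 := Real.exp_neg_one_lt_d9
  have l1 := exp_neg_mul_one_sub_le_pow (k := 1) (b := b) (by norm_num) (by omega) (by linarith)
  have l2 := exp_neg_mul_one_sub_le_pow (k := 2) (b := b) (by norm_num) (by omega) (by linarith)
  have l3 := exp_neg_mul_one_sub_le_pow (k := 3) (b := b) (by norm_num) (by omega) (by linarith)
  have u1 := Real.one_sub_div_pow_le_exp_neg (n := b) (t := 1) (by linarith)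
  have u2 := one_sub_two_div_pow_pred_le (b := b) (by omega)
  have x2 : Real.exp (-2) = Real.exp (-1) ^ 2 := by rw [← Real.exp_nat_mul]; norm_num
  have x3 : Real.exp (-3) = Real.exp (-1) ^ 3 := by rw [← Real.exp_nat_mul]; norm_num
  rw [x2] at l2
  rw [x3] at l3
  have hx0 : 0 ≤ 1 / (b : ℝ) := by positivity
  have hx1 : 1 / (b : ℝ) ≤ 1 / 11 := one_div_le_one_div_of_le (by norm_num) hbR
  have hpp : (1 - 1 / (b : ℝ)) ^ b = (1 - 1 / (b : ℝ)) ^ (b - 1) * (1 - 1 / (b : ℝ)) := by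
    rw [← pow_succ]; congr 1; omega
  have hqq : (1 - 2 / (b : ℝ)) ^ b = (1 - 2 / (b : ℝ)) ^ (b - 1) * (1 - 2 / (b : ℝ)) := by
    rw [← pow_succ]; congr 1; omega
  have d2 : 2 / (b : ℝ) = 2 * (1 / b) := by ring
  have d4 : (2 : ℝ) ^ 2 / b = 4 * (1 / b) := by ring
  have d9 : (3 : ℝ) ^ 2 / b = 9 * (1 / b) := by ring
  have d1 : (1 : ℝ) ^ 2 / b = 1 / b := by ring
  rw [d1] at l1
  rw [d4] at l2
  rw [d9] at l3
  clear d1 d4 d9 x2 x3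
  have hp'0 : 0 ≤ (1 - 1 / (b : ℝ)) ^ (b - 1) := pow_nonneg (by linarith) _
  have e2l : 0.135334 < Real.exp (-1) ^ 2 := by nlinarith
  have e2u : Real.exp (-1) ^ 2 < 0.135336 := by nlinarith
  have hg₂ : 1 - Real.exp (-1) ^ 2 * (1 - 4 * (1 / b)) ≤ 1 := by nlinarith
  have hg : 1 - (1 - Real.exp (-1) ^ 2 * (1 - 4 * (1 / b))) ≤
      (1 - Real.exp (-1) ^ 2 * (1 - 4 * (1 / b))) - (1 - Real.exp (-1) * (1 - 1 / b)) := by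
    nlinarith
  have hg' : (1 - Real.exp (-1) ^ 2 * (1 - 4 * (1 / b))) - (1 - Real.exp (-1) * (1 - 1 / b)) ≤
      1 - Real.exp (-1) * (1 - 1 / b) := by
    nlinarith
  have hS := sum_sq_le_of_card_le_three (f := f)
    (g₃ := 1 - Real.exp (-1) ^ 3 * (1 - 9 * (1 / b))) hf (by omega) hf1
    (fun T h => (hT T).trans (by rw [h, Nat.cast_one]; linarith))
    (fun T h => (hT T).trans (by rw [h, Nat.cast_ofNat]; linarith))
    (fun T h => (hT T).trans (by rw [h, Nat.cast_ofNat]; linarith)) hg₂ hg hg'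
  have hF0 : 0 ≤ ∑ y, f y := Finset.sum_nonneg fun y _ => hf y
  have hS0 : 0 ≤ ∑ y, f y ^ 2 := Finset.sum_nonneg fun y _ => sq_nonneg _
  obtain ⟨n1, n2⟩ := numeric_bounds (e := Real.exp (-1)) (x := 1 / (b : ℝ))
    (by linarith) (by linarith) hx0 hx1
  rw [hqq, d2]
  rw [d2] at u2
  clear hqq d2 l2 l3 hT
  generalize (1 - 1 / (b : ℝ)) ^ b = p at *
  generalize (1 - 1 / (b : ℝ)) ^ (b - 1) = p' at *
  generalize (1 - 2 * (1 / (b : ℝ))) ^ (b - 1) = q at *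
  generalize Real.exp (-1) = e at *
  generalize 1 / (b : ℝ) = x at *
  have hq : q * (1 - 2 * x) + q ≤ 2 * e ^ 2 * (1 - x) := by
    linarith [mul_le_mul_of_nonneg_right u2 (show 0 ≤ 2 * (1 - x) by linarith)]
  have hC : p + (p + p') ≤ 1.1446 := by
    linarith [mul_le_mul_of_nonneg_left hx1 hp'0]
  clear l1 hg hg' hg₂ hpp u2
  have key := quadratic_bound_of_sq (P := e) (C := 1.1446) (Q := 2 * e ^ 2 * (1 - x)) hF0 hf1
    (by nlinarith) hsq hS (by linarith) (by norm_num) (by nlinarith)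
    (by convert n1 using 3; ring) (by
      have : (e - 2 * e ^ 2 * (1 - x)) * ((1 - e * (1 - x)) ^ 2 +
        (1 - e ^ 2 * (1 - 4 * x) - (1 - e * (1 - x))) ^ 2 +
        (1 - e ^ 3 * (1 - 9 * x) - (1 - e ^ 2 * (1 - 4 * x))) *
          (1 - (1 - e ^ 2 * (1 - 4 * x)))) ≤ 0.0663 := by
        convert n2 using 3 <;> ring
      -- The claim follows from 0.5776 times `n1` plus 0.4224 times `n2`, where `0.5776 = 0.76 ^ 2`.
      nlinarith)
  have k1 := mul_le_mul_of_nonneg_right hC (mul_nonneg hF0 (sub_nonneg.2 hf1))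
  have k2 := mul_le_mul_of_nonneg_right u1 hS0
  have k3 := mul_le_mul_of_nonneg_right hq (sub_nonneg.2 hsq)
  linarith

/-- The lower bound on the probability that a bin is filled, as a function of the fractional
matching. -/
lemma quadratic_bound {Y : Type*} [Fintype Y] [DecidableEq Y] {f : Y → ℝ} {b : ℕ}
    (hb : 0 < b) (hY : Fintype.card Y = b) (hf : ∀ y, 0 ≤ f y) (hf1 : ∑ y, f y ≤ 1)
    (hT : ∀ T : Finset Y, ∑ y ∈ T, f y ≤ 1 - (1 - (T.card : ℝ) / b) ^ b) :
    0.684 * ∑ y, f y ≤ 1 - ((1 - ∑ y, f y) ^ 2 +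
      ((1 - 1 / (b : ℝ)) ^ b + ((1 - 1 / (b : ℝ)) ^ b + (1 - 1 / (b : ℝ)) ^ (b - 1))) *
        ((∑ y, f y) * (1 - ∑ y, f y)) +
      (1 - 1 / (b : ℝ)) ^ b * ∑ y, f y ^ 2 +
      ((1 - 2 / (b : ℝ)) ^ b + (1 - 2 / (b : ℝ)) ^ (b - 1)) *
        ((∑ y, f y) ^ 2 - ∑ y, f y ^ 2)) := by
  have hF0 : 0 ≤ ∑ y, f y := Finset.sum_nonneg fun y _ => hf y
  have hlin (c : ℝ) (hc : ∀ y, f y ≤ c) : ∑ y, f y ^ 2 ≤ c * ∑ y, f y := by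
    rw [Finset.mul_sum]
    refine Finset.sum_le_sum fun y _ => ?_
    rw [sq]
    exact mul_le_mul_of_nonneg_right (hc y) (hf y)
  -- For `b ≤ 10` the bound on the single largest value suffices; as `b` grows it would give only
  -- about 0.668 at `F = 1`.
  rcases lt_or_ge 10 b with h | h
  · refine quadratic_bound_of_card h hY hf hf1 hT ?_
    rw [sq]
    exact hlin _ fun y => Finset.single_le_sum (fun y _ => hf y) (Finset.mem_univ y)
  · have hS := hlin (1 - (1 - 1 / (b : ℝ)) ^ b) fun y => by simpa using hT {y}
    refine quadratic_bound_of_linear hF0 hf1 ?_ hS ?_ ?_ <;> clear hS hT hY <;>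
      interval_cases b <;> norm_num

end StochMatching
-- Decomposition of a fractional matching into matchings.
namespace StochMatching

/-- A fractional matching of a bipartite graph is a convex combination of matchings. -/
lemma exists_isMatchingDistribution {Y Z : Type*} [Fintype Y] [Fintype Z] [DecidableEq Y]
    [DecidableEq Z] {E : Y → Z → Prop} {f : Y → Z → ℝ} (hf : ∀ y z, 0 ≤ f y z)
    (hE : ∀ y z, f y z ≠ 0 → E y z) (hrow : ∀ y, ∑ z, f y z ≤ 1) (hcol : ∀ z, ∑ y, f y z ≤ 1) :
    ∃ μ : (Y → Option Z) → ℝ, IsMatchingDistribution E f μ := by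
  -- The diagonal blocks absorb the missing mass of rows and columns, making `D` doubly stochastic.
  -- A permutation in its Birkhoff decomposition is read as a matching through the block from `Y` to
  -- `Z`.
  let D : Matrix (Y ⊕ Z) (Y ⊕ Z) ℝ := Matrix.fromBlocks
    (Matrix.diagonal fun y => 1 - ∑ z, f y z) (Matrix.of f)
    (Matrix.of f).transpose (Matrix.diagonal fun z => 1 - ∑ y, f y z)
  have hD : D ∈ doublyStochastic ℝ (Y ⊕ Z) := by
    rw [mem_doublyStochastic_iff_sum]
    refine ⟨?_, ?_, ?_⟩
    · rintro (y | z) (y' | z')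
      · simp only [D, Matrix.fromBlocks_apply₁₁, Matrix.diagonal_apply]
        split_ifs
        · linarith [hrow y]
        · rfl
      · exact hf _ _
      · exact hf _ _
      · simp only [D, Matrix.fromBlocks_apply₂₂, Matrix.diagonal_apply]
        split_ifs
        · linarith [hcol z]
        · rfl
    · rintro (y | z) <;> simp [D, Matrix.diagonal_apply]
    · rintro (y | z) <;> simp [D, Matrix.diagonal_apply]
  obtain ⟨w, hw0, hw1, hwD⟩ := exists_eq_sum_perm_of_mem_doublyStochastic hD
  have hentry (i j : Y ⊕ Z) : ∑ σ with σ i = j, w σ = D i j := by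
    rw [← hwD, Matrix.sum_apply, Finset.sum_filter]
    refine Finset.sum_congr rfl fun σ _ => ?_
    simp [Equiv.Perm.permMatrix, PEquiv.toMatrix_apply, eq_comm]
  let m : Equiv.Perm (Y ⊕ Z) → Y → Option Z := fun σ y => (σ (Sum.inl y)).getRight?
  have hm (σ : Equiv.Perm (Y ⊕ Z)) (y : Y) (z : Z) :
      m σ y = some z ↔ σ (Sum.inl y) = Sum.inr z := by
    simp [m, Sum.getRight?_eq_some_iff]
  refine ⟨fun M => ∑ σ with m σ = M, w σ, ⟨?_, ?_, ?_, ?_⟩⟩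
  · exact fun M => Finset.sum_nonneg fun σ _ => hw0 σ
  · rw [← hw1]
    exact Finset.sum_fiberwise _ _ _
  · intro M hM
    obtain ⟨σ, hσ, hwσ⟩ := Finset.exists_ne_zero_of_sum_ne_zero hM
    obtain rfl := (Finset.mem_filter.1 hσ).2
    refine ⟨fun y z h => hE y z ?_, fun y y' z h h' => ?_⟩
    · have h1 : w σ ≤ D (Sum.inl y) (Sum.inr z) := by
        rw [← hentry]
        exact Finset.single_le_sum (fun σ _ => hw0 σ) (by simpa using (hm σ y z).1 h)
      have h2 : 0 < w σ := lt_of_le_of_ne (hw0 σ) hwσ.symm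
      exact (h2.trans_le h1).ne'
    · rw [hm] at h h'
      exact Sum.inl_injective (σ.injective (h.trans h'.symm))
  · intro y z _
    change _ = D (Sum.inl y) (Sum.inr z)
    rw [← hentry, Finset.sum_filter, ← Finset.sum_fiberwise (s := Finset.univ.filter _) (g := m)]
    refine Finset.sum_congr rfl fun M _ => ?_
    split_ifs with h
    · refine Finset.sum_congr ?_ fun _ _ => rfl
      ext σ
      simp only [Finset.mem_filter, Finset.mem_univ, true_and, ← hm]
      exact ⟨fun h' => ⟨h' ▸ h, h'⟩, fun h' => h'.2⟩
    · refine (Finset.sum_eq_zero fun σ hσ => absurd ?_ h).symm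
      simp only [Finset.mem_filter, Finset.mem_univ, true_and, ← hm] at hσ
      exact hσ.2 ▸ hσ.1

end StochMatching
-- When a bin is filled, and counts of arrival sequences.
namespace StochMatching

/-- A bin is full once some ball has been tried on it. -/
lemma mem_fullBins {Y Z : Type*} [DecidableEq Y] [DecidableEq Z] {M₁ M₂ : Y → Option Z} {b : ℕ}
    {ω : Fin b → Y} {z : Z} {t : Fin b} (ht : triedBin M₁ M₂ ω t = some z) (n : ℕ) (hn : t < n) :
    z ∈ fullBins M₁ M₂ ω n := by
  have hstep (s : Finset Z) (o : Option Z) : s ⊆ step s o := by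
    rcases o with _ | x
    · exact Finset.Subset.refl _
    · simp only [step]
      split_ifs
      · exact Finset.Subset.refl _
      · exact Finset.subset_insert _ _
  induction n with
  | zero => omega
  | succ n ih =>
    rw [fullBins]
    rcases Nat.lt_succ_iff_lt_or_eq.1 hn with h | h
    · split_ifs with hb
      · exact hstep _ _ (ih h)
      · exact ih h
    · have hb : n < b := h ▸ t.2
      have : (⟨n, hb⟩ : Fin b) = t := Fin.ext h.symm
      rw [dif_pos hb, this, ht]
      simp only [step]
      split_ifs with h'
      · exact h'
      · exact Finset.mem_insert_self _ _

/-- Arrival numbers increase strictly along the balls of type `y` and lie between 1 and their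
number, so they take every value in that range. -/
lemma exists_arrivalNumber_eq {Y : Type*} [DecidableEq Y] {b : ℕ} (ω : Fin b → Y) (y : Y) {k : ℕ}
    (hk : 1 ≤ k) (hk' : k ≤ (Finset.univ.filter fun t => ω t = y).card) :
    ∃ t, ω t = y ∧ arrivalNumber ω t = k := by
  set s := Finset.univ.filter fun t => ω t = y with hs
  have hinj : Set.InjOn (arrivalNumber ω) s := by
    have key : ∀ t ∈ s, ∀ u ∈ s, t < u → arrivalNumber ω t < arrivalNumber ω u := by
      intro t ht u hu htu
      have ht' : ω t = y := by simpa [hs] using ht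
      have hu' : ω u = y := by simpa [hs] using hu
      refine Finset.card_lt_card (Finset.ssubset_iff_of_subset ?_ |>.2 ⟨u, ?_, ?_⟩)
      · intro v
        simp only [Finset.mem_filter, Finset.mem_univ, true_and, ht', hu']
        exact fun h => ⟨h.1.trans htu.le, h.2⟩
      · simp
      · simp [htu]
    intro t ht u hu h
    rcases lt_trichotomy t u with h' | h' | h'
    · exact absurd h (key t ht u hu h').ne
    · exact h'
    · exact absurd h (key u hu t ht h').ne'
  have himg : s.image (arrivalNumber ω) = Finset.Icc 1 s.card := by
    refine Finset.eq_of_subset_of_card_le ?_ ?_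
    · intro n hn
      obtain ⟨t, ht, rfl⟩ := Finset.mem_image.1 hn
      have ht' : ω t = y := by simpa [hs] using ht
      refine Finset.mem_Icc.2 ⟨Finset.card_pos.2 ⟨t, by simp⟩, Finset.card_le_card ?_⟩
      intro u
      simp only [hs, Finset.mem_filter, Finset.mem_univ, true_and, ht']
      exact fun h => h.2
    · rw [Finset.card_image_of_injOn hinj, Nat.card_Icc]
      omega
  obtain ⟨t, ht, rfl⟩ := Finset.mem_image.1 (himg ▸ Finset.mem_Icc.2 ⟨hk, hk'⟩)
  exact ⟨t, by simpa [hs] using ht, rfl⟩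

lemma card_forall_notMem {Y : Type*} [Fintype Y] [DecidableEq Y] (b : ℕ) (T : Finset Y) :
    (Finset.univ.filter fun ω : Fin b → Y => ∀ t, ω t ∉ T).card =
      (Fintype.card Y - T.card) ^ b := by
  have : (Finset.univ.filter fun ω : Fin b → Y => ∀ t, ω t ∉ T) =
      Fintype.piFinset fun _ => Tᶜ := by
    ext ω; simp
  rw [this, Fintype.card_piFinset_const, Finset.card_compl]

/-- Either `y` never arrives, or some position `t` holds the only ball of type `y`; a union bound
over the `b` positions gives the second term. -/
lemma card_forall_notMem_count_le_one {Y : Type*} [Fintype Y] [DecidableEq Y] (b : ℕ)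
    (T : Finset Y) {y : Y} (hy : y ∉ T) :
    (Finset.univ.filter fun ω : Fin b → Y =>
      (∀ t, ω t ∉ T) ∧ (Finset.univ.filter fun t => ω t = y).card ≤ 1).card ≤
      (Fintype.card Y - (T.card + 1)) ^ b + b * (Fintype.card Y - (T.card + 1)) ^ (b - 1) := by
  have hsub : (Finset.univ.filter fun ω : Fin b → Y =>
      (∀ t, ω t ∉ T) ∧ (Finset.univ.filter fun t => ω t = y).card ≤ 1) ⊆
      (Finset.univ.filter fun ω : Fin b → Y => ∀ t, ω t ∉ insert y T) ∪
      Finset.univ.biUnion fun t : Fin b =>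
        Fintype.piFinset fun s => if s = t then {y} else (insert y T)ᶜ := by
    intro ω hω
    simp only [Finset.mem_filter, Finset.mem_univ, true_and] at hω
    simp only [Finset.mem_union, Finset.mem_filter, Finset.mem_univ, true_and,
      Finset.mem_biUnion, Fintype.mem_piFinset]
    by_cases h : ∃ t, ω t = y
    · obtain ⟨t, ht⟩ := h
      refine Or.inr ⟨t, fun s => ?_⟩
      split_ifs with hst
      · simp [hst, ht]
      · rw [Finset.mem_compl, Finset.mem_insert, not_or]
        exact ⟨fun hs => hst (Finset.card_le_one.1 hω.2 s (by simpa using hs) t (by simpa using ht)),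
          hω.1 s⟩
    · push Not at h
      refine Or.inl fun t => ?_
      rw [Finset.mem_insert, not_or]
      exact ⟨h t, hω.1 t⟩
  refine (Finset.card_le_card hsub).trans ((Finset.card_union_le _ _).trans ?_)
  rw [card_forall_notMem, Finset.card_insert_of_notMem hy]
  refine Nat.add_le_add_left (Finset.card_biUnion_le.trans ?_) _
  refine (Finset.sum_le_card_nsmul _ _ ((Fintype.card Y - (T.card + 1)) ^ (b - 1)) ?_).trans ?_
  · intro t _
    rw [Fintype.card_piFinset, ← Finset.mul_prod_erase _ _ (Finset.mem_univ t), if_pos rfl,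
      Finset.card_singleton, one_mul, Finset.prod_congr rfl (g := fun _ =>
        Fintype.card Y - (T.card + 1))]
    · simp
    · intro s hs
      rw [if_neg (Finset.ne_of_mem_erase hs), Finset.card_compl, Finset.card_insert_of_notMem hy]
  · simp

end StochMatching
-- Probabilities of arrival events.
namespace StochMatching

section UniformArrivals

variable {Y : Type*} [Fintype Y] {r : Y → ℝ} {b : ℕ}

lemma seqProb_eq_inv_pow (hr : ∀ y, r y = 1) (hb : ∑ y, r y = (b : ℝ)) (ω : Fin b → Y) :
    seqProb r ω = (b : ℝ)⁻¹ ^ b := by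
  simp [seqProb, hr, ← hb]

lemma card_eq_of_sum_rate (hr : ∀ y, r y = 1) (hb : ∑ y, r y = (b : ℝ)) :
    Fintype.card Y = b := by
  simp only [hr, Finset.sum_const, Finset.card_univ, nsmul_eq_mul, mul_one] at hb
  exact_mod_cast hb

lemma sum_seqProb (hr : ∀ y, r y = 1) (hb : ∑ y, r y = (b : ℝ)) :
    ∑ ω : Fin b → Y, seqProb r ω = 1 := by
  classical
  simp only [seqProb_eq_inv_pow hr hb, Finset.sum_const, Finset.card_univ, nsmul_eq_mul,
    Fintype.card_fun, card_eq_of_sum_rate hr hb, Fintype.card_fin]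
  rcases Nat.eq_zero_or_pos b with rfl | h
  · simp
  · have : (b : ℝ) ≠ 0 := by positivity
    rw [Nat.cast_pow, ← mul_pow, mul_inv_cancel₀ this, one_pow]

lemma seqProb_nonneg (hr : ∀ y, r y = 1) (hb : ∑ y, r y = (b : ℝ)) (ω : Fin b → Y) :
    0 ≤ seqProb r ω := by
  rw [seqProb_eq_inv_pow hr hb]; positivity

variable [DecidableEq Y]

lemma sum_seqProb_forall_notMem (hr : ∀ y, r y = 1) (hb : ∑ y, r y = (b : ℝ)) (hb0 : 0 < b)
    (T : Finset Y) :
    ∑ ω : Fin b → Y with ∀ t, ω t ∉ T, seqProb r ω = (1 - (T.card : ℝ) / b) ^ b := by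
  have hY := card_eq_of_sum_rate hr hb
  have hTb : T.card ≤ b := hY ▸ T.card_le_univ
  have : (b : ℝ) ≠ 0 := by positivity
  simp only [seqProb_eq_inv_pow hr hb, Finset.sum_const, card_forall_notMem, nsmul_eq_mul, hY]
  rw [Nat.cast_pow, ← mul_pow, Nat.cast_sub hTb]
  congr 1
  field_simp

lemma sum_seqProb_forall_notMem_count_le_one (hr : ∀ y, r y = 1) (hb : ∑ y, r y = (b : ℝ))
    (hb0 : 0 < b) (T : Finset Y) {y : Y} (hy : y ∉ T) :
    ∑ ω : Fin b → Y with (∀ t, ω t ∉ T) ∧ (Finset.univ.filter fun t => ω t = y).card ≤ 1,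
      seqProb r ω ≤ (1 - ((T.card + 1 : ℕ) : ℝ) / b) ^ b +
        (1 - ((T.card + 1 : ℕ) : ℝ) / b) ^ (b - 1) := by
  have hY := card_eq_of_sum_rate hr hb
  have hTb : T.card + 1 ≤ b := by
    rw [← hY, ← Finset.card_insert_of_notMem hy]
    exact Finset.card_le_univ _
  have hb' : (b : ℝ) ≠ 0 := by positivity
  have hc : (1 - ((T.card + 1 : ℕ) : ℝ) / b) = ((b - (T.card + 1) : ℕ) : ℝ) * (b : ℝ)⁻¹ := by
    rw [Nat.cast_sub hTb]
    field_simp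
  simp only [seqProb_eq_inv_pow hr hb, Finset.sum_const, nsmul_eq_mul]
  have h := card_forall_notMem_count_le_one b T hy
  rw [hY] at h
  calc _ ≤ (((b - (T.card + 1)) ^ b + b * (b - (T.card + 1)) ^ (b - 1) : ℕ) : ℝ) *
        (b : ℝ)⁻¹ ^ b := by
        gcongr
    _ = _ := by
        rw [hc, mul_pow, mul_pow]
        push_cast
        -- The factor `b` counting positions cancels one factor `b⁻¹`, which lowers the exponent to
        -- `b - 1`.
        obtain ⟨n, rfl⟩ : ∃ n, b = n + 1 := ⟨b - 1, by omega⟩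
        rw [Nat.add_sub_cancel, pow_succ (((n + 1 : ℕ) : ℝ)⁻¹)]
        push_cast at hb' ⊢
        field_simp

/-- The expected number of balls of each type is `1`. -/
lemma sum_seqProb_mul_count (hr : ∀ y, r y = 1) (hb : ∑ y, r y = (b : ℝ)) (y : Y) :
    ∑ ω : Fin b → Y, seqProb r ω * ((Finset.univ.filter fun t => ω t = y).card : ℝ) = 1 := by
  have hY := card_eq_of_sum_rate hr hb
  have hb0 : 0 < b := hY ▸ Fintype.card_pos_iff.2 ⟨y⟩
  have hcard (t : Fin b) : (Finset.univ.filter fun ω : Fin b → Y => ω t = y).card =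
      b ^ (b - 1) := by
    have : (Finset.univ.filter fun ω : Fin b → Y => ω t = y) =
        Fintype.piFinset fun s => if s = t then {y} else Finset.univ := by
      ext ω
      simp only [Finset.mem_filter, Finset.mem_univ, true_and, Fintype.mem_piFinset]
      refine ⟨fun h s => ?_, fun h => by simpa using h t⟩
      split_ifs with hs
      · simp [hs, h]
      · simp
    rw [this, Fintype.card_piFinset, ← Finset.mul_prod_erase _ _ (Finset.mem_univ t), if_pos rfl,
      Finset.card_singleton, one_mul, Finset.prod_congr rfl (g := fun _ => b)]
    · simp
    · intro s hs
      rw [if_neg (Finset.ne_of_mem_erase hs), Finset.card_univ, hY]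
  have hswap : ∑ ω : Fin b → Y, (Finset.univ.filter fun t => ω t = y).card = b ^ b := by
    simp only [Finset.card_filter]
    rw [Finset.sum_comm]
    simp only [← Finset.card_filter, hcard, Finset.sum_const, Finset.card_univ, Fintype.card_fin,
      smul_eq_mul]
    rw [← pow_succ']
    congr 1
    omega
  simp only [seqProb_eq_inv_pow hr hb]
  rw [← Finset.mul_sum, ← Nat.cast_sum, hswap, Nat.cast_pow, ← mul_pow,
    inv_mul_cancel₀ (by positivity), one_pow]

end UniformArrivals

/-! ### The fractional matching of the offline optimum. -/

section OfflineOptimum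

lemma sum_usesEdge {Y Z : Type*} [DecidableEq Y] [DecidableEq Z] {b : ℕ}
    {F : (Fin b → Y) → Fin b → Option Z} (ω : Fin b → Y) (T : Finset Y) (z : Z) :
    ∑ y ∈ T, usesEdge F ω y z =
      (Finset.univ.filter fun t => ω t ∈ T ∧ F ω t = some z).card := by
  rw [Finset.card_eq_sum_card_fiberwise (f := ω) (t := T)]
  · refine Finset.sum_congr rfl fun y hy => congrArg Finset.card ?_
    ext t
    simp only [Finset.mem_filter, Finset.mem_univ, true_and]
    constructor
    · rintro ⟨rfl, h⟩
      exact ⟨⟨hy, h⟩, rfl⟩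
    · rintro ⟨⟨-, h⟩, rfl⟩
      exact ⟨rfl, h⟩
  · intro t ht
    simpa using (Finset.mem_filter.1 ht).2.1

variable {Y Z : Type*} [Fintype Y] [DecidableEq Y] [DecidableEq Z] {E : Y → Z → Prop}
  {r : Y → ℝ} {b : ℕ} {F : (Fin b → Y) → Fin b → Option Z}

lemma fracMatching_nonneg (hr : ∀ y, r y = 1) (hb : ∑ y, r y = (b : ℝ)) (y : Y) (z : Z) :
    0 ≤ fracMatching r F y z :=
  Finset.sum_nonneg fun ω _ => mul_nonneg (seqProb_nonneg hr hb ω) (Nat.cast_nonneg _)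

lemma adj_of_fracMatching_ne_zero (hF : IsOfflineOptimum E F) {y : Y} {z : Z}
    (h : fracMatching r F y z ≠ 0) : E y z := by
  obtain ⟨ω, -, hω⟩ := Finset.exists_ne_zero_of_sum_ne_zero h
  have h' : usesEdge F ω y z ≠ 0 := fun h0 => hω (by simp [h0])
  obtain ⟨t, ht⟩ := Finset.card_ne_zero.1 h'
  simp only [Finset.mem_filter, Finset.mem_univ, true_and] at ht
  exact ht.1 ▸ (hF ω).1.1 t z ht.2

/-- Pointwise in `ω`: the balls with types in `T` fill `z` at most once, and not at all if no such
ball arrives. -/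
lemma sum_fracMatching_le (hr : ∀ y, r y = 1) (hb : ∑ y, r y = (b : ℝ)) (hb0 : 0 < b)
    (hF : IsOfflineOptimum E F) (T : Finset Y) (z : Z) :
    ∑ y ∈ T, fracMatching r F y z ≤ 1 - (1 - (T.card : ℝ) / b) ^ b := by
  simp only [fracMatching]
  rw [Finset.sum_comm, ← sum_seqProb_forall_notMem hr hb hb0 T, ← sum_seqProb hr hb,
    Finset.sum_filter, ← Finset.sum_sub_distrib]
  refine Finset.sum_le_sum fun ω _ => ?_
  rw [← Finset.mul_sum, ← Nat.cast_sum, sum_usesEdge]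
  split_ifs with h
  · simp [h]
  · rw [sub_zero]
    refine mul_le_of_le_one_right (seqProb_nonneg hr hb ω) ?_
    rw [Nat.cast_le_one, Finset.card_le_one]
    intro t ht u hu
    exact (hF ω).1.2 t u z (Finset.mem_filter.1 ht).2.2 (Finset.mem_filter.1 hu).2.2

lemma sum_fracMatching_le_one (hr : ∀ y, r y = 1) (hb : ∑ y, r y = (b : ℝ))
    (hF : IsOfflineOptimum E F) (z : Z) : ∑ y, fracMatching r F y z ≤ 1 := by
  have hY := card_eq_of_sum_rate hr hb
  rcases Nat.eq_zero_or_pos b with rfl | hb0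
  · have := Fintype.card_eq_zero_iff.1 hY
    simp
  · refine (sum_fracMatching_le hr hb hb0 hF Finset.univ z).trans ?_
    rw [Finset.card_univ, hY, div_self (by positivity), sub_self]
    simp [hb0.ne']

variable [Fintype Z]

lemma sum_card_filter_eq_some (o : Fin b → Option Z) (p : Fin b → Prop) [DecidablePred p] :
    ∑ z, (Finset.univ.filter fun t => p t ∧ o t = some z).card =
      (Finset.univ.filter fun t => p t ∧ (o t).isSome = true).card := by
  simp only [Finset.card_filter]
  rw [Finset.sum_comm]
  refine Finset.sum_congr rfl fun t _ => ?_
  rcases h : o t with _ | x <;> by_cases hp : p t <;> simp [hp]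

lemma sum_fracMatching_bins_le_one (hr : ∀ y, r y = 1) (hb : ∑ y, r y = (b : ℝ)) (y : Y) :
    ∑ z, fracMatching r F y z ≤ 1 := by
  simp only [fracMatching]
  rw [Finset.sum_comm, ← sum_seqProb_mul_count hr hb y]
  refine Finset.sum_le_sum fun ω _ => ?_
  rw [← Finset.mul_sum, ← Nat.cast_sum]
  refine mul_le_mul_of_nonneg_left (Nat.cast_le.2 ?_) (seqProb_nonneg hr hb ω)
  simp only [usesEdge]
  rw [sum_card_filter_eq_some]
  exact Finset.card_le_card fun t => by
    simp only [Finset.mem_filter, Finset.mem_univ, true_and]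
    exact fun h => h.1

lemma expectedOpt_eq_sum_fracMatching :
    expectedOpt r F = ∑ z, ∑ y, fracMatching r F y z := by
  simp only [fracMatching, expectedOpt]
  simp_rw [Finset.sum_comm (s := (Finset.univ : Finset Y))]
  rw [Finset.sum_comm]
  refine Finset.sum_congr rfl fun ω _ => ?_
  simp_rw [← Finset.mul_sum, ← Nat.cast_sum, sum_usesEdge]
  rw [sum_card_filter_eq_some]
  simp [size]

end OfflineOptimum

end StochMatching
-- The online algorithm.
namespace StochMatching

section Online

lemma forall_ne_of_notMem_fullBins {Y Z : Type*} [DecidableEq Y] [DecidableEq Z] {b : ℕ}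
    {M₁ M₂ : Y → Option Z} {z : Z} {ω : Fin b → Y}
    (hz : z ∉ fullBins M₁ M₂ ω b) {y : Y}
    (hy : M₁ y = some z) (t : Fin b) : ω t ≠ y := by
  intro ht
  obtain ⟨s, hs, hs1⟩ := exists_arrivalNumber_eq ω y le_rfl
    (Finset.card_pos.2 ⟨t, by simpa using ht⟩)
  exact hz (mem_fullBins (t := s) (by rw [triedBin, if_pos hs1, hs, hy]) b s.2)

lemma count_le_one_of_notMem_fullBins {Y Z : Type*} [DecidableEq Y] [DecidableEq Z] {b : ℕ}
    {M₁ M₂ : Y → Option Z} {z : Z} {ω : Fin b → Y}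
    (hz : z ∉ fullBins M₁ M₂ ω b) {y : Y}
    (hy : M₂ y = some z) : (Finset.univ.filter fun t => ω t = y).card ≤ 1 := by
  by_contra! h
  obtain ⟨s, hs, hs2⟩ := exists_arrivalNumber_eq ω y one_le_two h
  exact hz (mem_fullBins (t := s) (by simp [triedBin, hs2, hs, hy]) b s.2)

variable {Y Z : Type*} [Fintype Y] [DecidableEq Y] [DecidableEq Z] {E : Y → Z → Prop}
  {r : Y → ℝ} {b : ℕ} {M₁ M₂ : Y → Option Z} {z : Z}

/-- The probability that bin `z` stays empty when the priority matchings are `M₁` and `M₂`. -/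
noncomputable def emptyProb (r : Y → ℝ) (b : ℕ) (M₁ M₂ : Y → Option Z) (z : Z) : ℝ :=
  ∑ ω : Fin b → Y with z ∉ fullBins M₁ M₂ ω b, seqProb r ω

lemma emptyProb_le_of_imp (hr : ∀ y, r y = 1) (hb : ∑ y, r y = (b : ℝ))
    (P : (Fin b → Y) → Prop) [DecidablePred P] (hP : ∀ ω, z ∉ fullBins M₁ M₂ ω b → P ω) :
    emptyProb r b M₁ M₂ z ≤ ∑ ω with P ω, seqProb r ω :=
  Finset.sum_le_sum_of_subset_of_nonneg
    (fun ω hω => Finset.mem_filter.2 ⟨Finset.mem_univ _, hP ω (Finset.mem_filter.1 hω).2⟩)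
    fun ω _ _ => seqProb_nonneg hr hb ω

/-- The indicator of the edges at bin `z` in the matching `M`. -/
noncomputable def edgeIndicator (z : Z) (M : Y → Option Z) (y : Y) : ℝ :=
  if M y = some z then 1 else 0

lemma edgeIndicator_eq (hM : IsMatching E M₁) (z : Z) :
    (∀ y, M₁ y ≠ some z ∧ edgeIndicator z M₁ y = 0) ∨
      ∃ y, M₁ y = some z ∧ ∀ y', edgeIndicator z M₁ y' = if y' = y then 1 else 0 := by
  by_cases h : ∃ y, M₁ y = some z
  · obtain ⟨y, hy⟩ := h
    refine Or.inr ⟨y, hy, fun y' => ?_⟩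
    rw [edgeIndicator]
    refine if_congr ⟨fun h' => hM.2 y' y z h' hy, ?_⟩ rfl rfl
    rintro rfl
    exact hy
  · push Not at h
    exact Or.inl fun y => ⟨h y, if_neg (h y)⟩

/-- The right side interpolates the cases: 1 without partners, `p` or `p'` with only an `M₁`- or
`M₂`-partner, `q` for distinct partners, `p` for equal ones. In this form each term can be averaged
using independence and the marginals. -/
lemma emptyProb_le (hr : ∀ y, r y = 1) (hb : ∑ y, r y = (b : ℝ)) (hb0 : 0 < b)
    (h₁ : IsMatching E M₁) (h₂ : IsMatching E M₂) (z : Z) {p p' q : ℝ}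
    (hp : p = (1 - 1 / (b : ℝ)) ^ b)
    (hp' : p' = (1 - 1 / (b : ℝ)) ^ b + (1 - 1 / (b : ℝ)) ^ (b - 1))
    (hq : q = (1 - 2 / (b : ℝ)) ^ b + (1 - 2 / (b : ℝ)) ^ (b - 1)) :
    emptyProb r b M₁ M₂ z ≤ 1 + (p - 1) * ∑ y, edgeIndicator z M₁ y +
      (p' - 1) * ∑ y, edgeIndicator z M₂ y +
      (1 - p - p' + q) * ((∑ y, edgeIndicator z M₁ y) * ∑ y, edgeIndicator z M₂ y) +
      (p - q) * ∑ y, edgeIndicator z M₁ y * edgeIndicator z M₂ y := by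
  have bound₁ {y : Y} (hy : M₁ y = some z) : emptyProb r b M₁ M₂ z ≤ p := by
    refine (emptyProb_le_of_imp hr hb (fun ω => ∀ t, ω t ∉ ({y} : Finset Y)) ?_).trans ?_
    · exact fun ω hω t ht => forall_ne_of_notMem_fullBins hω hy t (by simpa using ht)
    · rw [sum_seqProb_forall_notMem hr hb hb0, hp, Finset.card_singleton, Nat.cast_one]
  rcases edgeIndicator_eq h₁ z with e₁ | ⟨y, hy, e₁⟩ <;>
    rcases edgeIndicator_eq h₂ z with e₂ | ⟨y', hy', e₂⟩
  · simp only [fun y => (e₁ y).2, fun y => (e₂ y).2]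
    refine (emptyProb_le_of_imp hr hb (fun _ => True) fun _ _ => trivial).trans ?_
    simp [sum_seqProb hr hb]
  · simp only [fun y => (e₁ y).2, e₂]
    refine (emptyProb_le_of_imp hr hb (fun ω => (∀ t, ω t ∉ (∅ : Finset Y)) ∧
      (Finset.univ.filter fun t => ω t = y').card ≤ 1) ?_).trans
      ((sum_seqProb_forall_notMem_count_le_one hr hb hb0 ∅ (Finset.notMem_empty y')).trans ?_)
    · exact fun ω hω => ⟨by simp, count_le_one_of_notMem_fullBins hω hy'⟩
    · simp [hp']
  · simp only [fun y => (e₂ y).2, e₁]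
    simpa using bound₁ hy
  · simp only [e₁, e₂, ite_mul, one_mul, zero_mul, Finset.sum_ite_eq', Finset.mem_univ, if_true]
    split_ifs with h
    · linarith [bound₁ hy]
    · refine (emptyProb_le_of_imp hr hb (fun ω => (∀ t, ω t ∉ ({y} : Finset Y)) ∧
        (Finset.univ.filter fun t => ω t = y').card ≤ 1) ?_).trans
        ((sum_seqProb_forall_notMem_count_le_one hr hb hb0 {y}
          (by simpa using fun h' => h (Eq.symm h'))).trans ?_)
      · exact fun ω hω => ⟨fun t ht => forall_ne_of_notMem_fullBins hω hy t (by simpa using ht),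
          count_le_one_of_notMem_fullBins hω hy'⟩
      · rw [Finset.card_singleton, one_add_one_eq_two, Nat.cast_ofNat, ← hq]
        linarith

variable [Fintype Z] {F : (Fin b → Y) → Fin b → Option Z} {μ : (Y → Option Z) → ℝ}

lemma sum_mul_edgeIndicator (hF : IsOfflineOptimum E F)
    (hμ : IsMatchingDistribution E (fracMatching r F) μ) (y : Y) (z : Z) :
    ∑ M, μ M * edgeIndicator z M y = fracMatching r F y z := by
  by_cases h : E y z
  · rw [← hμ.marginal y z h, Finset.sum_filter]
    refine Finset.sum_congr rfl fun M _ => ?_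
    rw [edgeIndicator, mul_ite, mul_one, mul_zero]
  -- The marginal condition covers only edges of `E`; off `E` both sides vanish.
  · have h0 : fracMatching r F y z = 0 := by
      by_contra h'
      exact h (adj_of_fracMatching_ne_zero hF h')
    rw [h0]
    refine Finset.sum_eq_zero fun M _ => ?_
    by_cases hM : μ M = 0
    · rw [hM, zero_mul]
    · rw [edgeIndicator, if_neg fun h' => h ((hμ.support M hM).1 y z h'), mul_zero]

lemma sum_sum_mul_emptyProb_le (hr : ∀ y, r y = 1) (hb : ∑ y, r y = (b : ℝ)) (hb0 : 0 < b)
    (hF : IsOfflineOptimum E F) (hμ : IsMatchingDistribution E (fracMatching r F) μ) (z : Z) :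
    ∑ M₁, ∑ M₂, μ M₁ * μ M₂ * emptyProb r b M₁ M₂ z ≤
      (1 - ∑ y, fracMatching r F y z) ^ 2 +
      ((1 - 1 / (b : ℝ)) ^ b + ((1 - 1 / (b : ℝ)) ^ b + (1 - 1 / (b : ℝ)) ^ (b - 1))) *
        ((∑ y, fracMatching r F y z) * (1 - ∑ y, fracMatching r F y z)) +
      (1 - 1 / (b : ℝ)) ^ b * ∑ y, fracMatching r F y z ^ 2 +
      ((1 - 2 / (b : ℝ)) ^ b + (1 - 2 / (b : ℝ)) ^ (b - 1)) *
        ((∑ y, fracMatching r F y z) ^ 2 - ∑ y, fracMatching r F y z ^ 2) := by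
  obtain ⟨p, hp⟩ : ∃ p, p = (1 - 1 / (b : ℝ)) ^ b := ⟨_, rfl⟩
  obtain ⟨p', hp'⟩ : ∃ p', p' = (1 - 1 / (b : ℝ)) ^ b + (1 - 1 / (b : ℝ)) ^ (b - 1) := ⟨_, rfl⟩
  obtain ⟨q, hq⟩ : ∃ q, q = (1 - 2 / (b : ℝ)) ^ b + (1 - 2 / (b : ℝ)) ^ (b - 1) := ⟨_, rfl⟩
  have prod (u v : (Y → Option Z) → ℝ) : ∑ M₁, ∑ M₂, μ M₁ * μ M₂ * (u M₁ * v M₂) =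
      (∑ M, μ M * u M) * ∑ M, μ M * v M := by
    rw [Finset.sum_mul_sum]
    exact Finset.sum_congr rfl fun _ _ => Finset.sum_congr rfl fun _ _ => by ring
  have total : ∑ M, μ M * ∑ y, edgeIndicator z M y = ∑ y, fracMatching r F y z := by
    simp_rw [Finset.mul_sum]
    rw [Finset.sum_comm]
    exact Finset.sum_congr rfl fun y _ => sum_mul_edgeIndicator hF hμ y z
  have one : ∑ M, μ M * (1 : ℝ) = 1 := by simpa using hμ.sum_eq_one
  have h0 := prod (fun _ => 1) fun _ => 1
  have h1 := prod (fun M => ∑ y, edgeIndicator z M y) fun _ => 1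
  have h2 := prod (fun _ => 1) fun M => ∑ y, edgeIndicator z M y
  have h3 := prod (fun M => ∑ y, edgeIndicator z M y) fun M => ∑ y, edgeIndicator z M y
  -- By independence, both matchings contain `(y, z)` with probability `f y z ^ 2`.
  have h4 : ∑ M₁, ∑ M₂, μ M₁ * μ M₂ * ∑ y, edgeIndicator z M₁ y * edgeIndicator z M₂ y =
      ∑ y, fracMatching r F y z ^ 2 := by
    simp_rw [← sum_mul_edgeIndicator hF hμ _ z, sq, ← prod, Finset.mul_sum]
    rw [Finset.sum_comm]
    simp_rw [Finset.sum_comm (s := (Finset.univ : Finset Y))]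
    rw [Finset.sum_comm]
  simp only [total, one] at h0 h1 h2 h3
  calc ∑ M₁, ∑ M₂, μ M₁ * μ M₂ * emptyProb r b M₁ M₂ z
      ≤ ∑ M₁, ∑ M₂, (μ M₁ * μ M₂ * (1 * 1) +
        (p - 1) * (μ M₁ * μ M₂ * ((∑ y, edgeIndicator z M₁ y) * 1)) +
        (p' - 1) * (μ M₁ * μ M₂ * (1 * ∑ y, edgeIndicator z M₂ y)) +
        (1 - p - p' + q) * (μ M₁ * μ M₂ *
          ((∑ y, edgeIndicator z M₁ y) * ∑ y, edgeIndicator z M₂ y)) +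
        (p - q) * (μ M₁ * μ M₂ * ∑ y, edgeIndicator z M₁ y * edgeIndicator z M₂ y)) := by
        refine Finset.sum_le_sum fun M₁ _ => Finset.sum_le_sum fun M₂ _ => ?_
        -- Only functions in the support of `μ` are known to be matchings.
        by_cases hM₁ : μ M₁ = 0
        · simp [hM₁]
        by_cases hM₂ : μ M₂ = 0
        · simp [hM₂]
        have := mul_le_mul_of_nonneg_left (emptyProb_le hr hb hb0 (hμ.support M₁ hM₁)
          (hμ.support M₂ hM₂) z hp hp' hq) (mul_nonneg (hμ.nonneg M₁) (hμ.nonneg M₂))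
        linarith
    _ = _ := by
        simp only [Finset.sum_add_distrib, ← Finset.mul_sum, h0, h1, h2, h3, h4]
        rw [← hp', ← hq, ← hp]
        ring

lemma expectedAlg_eq_sum (hr : ∀ y, r y = 1) (hb : ∑ y, r y = (b : ℝ)) (hμ : ∑ M, μ M = 1) :
    expectedAlg r b μ =
      ∑ z, (1 - ∑ M₁, ∑ M₂, μ M₁ * μ M₂ * emptyProb r b M₁ M₂ z) := by
  have hfill (M₁ M₂ : Y → Option Z) :
      ∑ ω : Fin b → Y, μ M₁ * μ M₂ * seqProb r ω * ((fullBins M₁ M₂ ω b).card : ℝ) =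
      ∑ z, (μ M₁ * μ M₂ - μ M₁ * μ M₂ * emptyProb r b M₁ M₂ z) := by
    have h (ω : Fin b → Y) : ((fullBins M₁ M₂ ω b).card : ℝ) =
        ∑ z, (1 - if z ∉ fullBins M₁ M₂ ω b then 1 else 0 : ℝ) := by
      have (z : Z) : (1 - if z ∉ fullBins M₁ M₂ ω b then 1 else 0 : ℝ) =
          if z ∈ fullBins M₁ M₂ ω b then 1 else 0 := by
        by_cases hz : z ∈ fullBins M₁ M₂ ω b <;> simp [hz]
      simp_rw [this]
      simp
    simp_rw [h, Finset.mul_sum]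
    rw [Finset.sum_comm]
    refine Finset.sum_congr rfl fun z _ => ?_
    rw [emptyProb, Finset.sum_filter]
    simp_rw [mul_assoc, ← Finset.mul_sum, mul_sub, Finset.sum_sub_distrib, mul_one,
      sum_seqProb hr hb, mul_sub, mul_one, mul_ite, mul_one, mul_zero]
  have htot : ∑ M₁, ∑ M₂, μ M₁ * μ M₂ = 1 := by
    rw [← Finset.sum_mul_sum, hμ, one_mul]
  simp only [expectedAlg, hfill]
  simp_rw [Finset.sum_comm (t := (Finset.univ : Finset Z))]
  refine Finset.sum_congr rfl fun z _ => ?_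
  simp only [Finset.sum_sub_distrib, htot]

end Online

end StochMatching

theorem mainTheorem4 {Y Z : Type*} [Fintype Y] [Fintype Z] [DecidableEq Y] [DecidableEq Z]
    (E : Y → Z → Prop) (r : Y → ℝ) (hr : ∀ y, r y = 1) (b : ℕ) (hb : ∑ y, r y = (b : ℝ))
    (F : (Fin b → Y) → Fin b → Option Z) (hF : StochMatching.IsOfflineOptimum E F) :
    (∃ μ : (Y → Option Z) → ℝ,
      StochMatching.IsMatchingDistribution E (StochMatching.fracMatching r F) μ) ∧
    ∀ μ : (Y → Option Z) → ℝ,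
      StochMatching.IsMatchingDistribution E (StochMatching.fracMatching r F) μ →
        (0.684 : ℝ) * StochMatching.expectedOpt r F ≤ StochMatching.expectedAlg r b μ := by
  open StochMatching in
  refine ⟨exists_isMatchingDistribution (fracMatching_nonneg hr hb)
    (fun y z => adj_of_fracMatching_ne_zero hF) (sum_fracMatching_bins_le_one hr hb)
    (sum_fracMatching_le_one hr hb hF), fun μ hμ => ?_⟩
  rcases Nat.eq_zero_or_pos b with rfl | hb0
  · have h0 : expectedOpt r F = 0 := by simp [expectedOpt, size]
    have h1 : expectedAlg r 0 μ = 0 := by simp [expectedAlg, fullBins]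
    simp [h0, h1]
  · rw [expectedOpt_eq_sum_fracMatching, expectedAlg_eq_sum hr hb hμ.sum_eq_one, Finset.mul_sum]
    refine Finset.sum_le_sum fun z _ => ?_
    refine (quadratic_bound hb0 (card_eq_of_sum_rate hr hb)
      (fun y => fracMatching_nonneg hr hb y z) (sum_fracMatching_le_one hr hb hF z)
      (fun T => sum_fracMatching_le hr hb hb0 hF T z)).trans ?_
    exact sub_le_sub_left (sum_sum_mul_emptyProb_le hr hb hb0 hF hμ z) 1
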